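/- Let $d$ be a positive odd integer, $n$ a number of modes and $\ell=\sqrt{2\pi/d}$. For $\mathbf a=(\mathbf a_X,\mathbf a_Z)$ and $\mathbf b=(\mathbf b_X,\mathbf b_Z)$ in $\mathbb R^{2n}$ put $[\mathbf a,\mathbf b]=\mathbf a_X\cdot\mathbf b_Z-\mathbf a_Z\cdot\mathbf b_X$, and let $\hat T_{\mathbf a}=e^{-i\ell(\mathbf a_X\cdot\hat{\mathbf p}-\mathbf a_Z\cdot\hat{\mathbf q})}$ be the displacement operator, where $\hat{\mathbf q}$ and $\hat{\mathbf p}=-i\nabla$ are the position and momentum operators on $\mathbb R^n$; explicitly, $(\hat T_{\mathbf a}f)(\mathbf x)=e^{i\ell\,\mathbf a_Z\cdot\mathbf x-i\pi\,\mathbf a_X\cdot\mathbf a_Z/d}f(\mathbf x-\ell\mathbf a_X)$. The Zak-Gross phase point operator at $\boldsymbol\eta\in[0,d\ell)^{2n}$ is $$\hat A_{\boldsymbol\eta}=\frac1{(2\pi)^n}\sum_{\mathbf a\in\mathbb Z^{2n}}e^{i\ell[\mathbf a,\boldsymbol\eta]+i\pi\,\mathbf a_X\cdot\mathbf a_Z}\,\hat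 T_{\mathbf a}.$$ For an integer $j$ let $|j_{\mathrm{GKP}}\rangle=\ell^{-1/2}\sum_{m\in\mathbb Z}|(dm+j)\ell\rangle$ (position eigenkets; a tempered distribution on $\mathbb R$), and let the logical parity operator be $$\hat\Pi_d^L=\Bigl(\sum_{j=0}^{d-1}|-j_{\mathrm{GKP}}\rangle\langle j_{\mathrm{GKP}}|\Bigr)^{\otimes n}.$$ Both are understood as linear maps from the Schwartz space $\mathcal S(\mathbb R^n)$ to the tempered distributions $\mathcal S'(\mathbb R^n)$, with convergence of operator sums meaning convergence of all matrix elements between Schwartz functions. Then the sum that defines $\hat A_{\boldsymbol\eta}$ at $\boldsymbol\eta=\mathbf 0$ converges unconditionally, and $$\hat A_{\mathbf 0}=\hat\Pi_d^L .$$ -/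

import Mathlib

open scoped SchwartzMap

noncomputable section

namespace GKP

/-- The configuration space `ℝⁿ` of `n` modes. -/
abbrev Config (n : ℕ) := EuclideanSpace ℝ (Fin n)

/-- The phase space `ℝ²ⁿ`; a vector `a = (a_X, a_Z)` is a pair, `a.1 = a_X` and `a.2 = a_Z`. -/
abbrev PhaseSpace (n : ℕ) := Config n × Config n

/-- The symplectic form `[a, b] = aᵀ Ω b = a_X · b_Z - a_Z · b_X`. -/
def symp {n : ℕ} (a b : PhaseSpace n) : ℝ := inner ℝ a.1 b.2 - inner ℝ a.2 b.1

/-- An integer vector as a point of `ℝⁿ`. -/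
def intVec {n : ℕ} (m : Fin n → ℤ) : Config n := WithLp.toLp 2 fun k => (m k : ℝ)

/-- An integer vector `(a_X, a_Z) ∈ ℤ²ⁿ` as a point of phase space. -/
def intPhase {n : ℕ} (a : (Fin n → ℤ) × (Fin n → ℤ)) : PhaseSpace n := (intVec a.1, intVec a.2)

/-- Generalized operators: continuous linear maps from Schwartz wave functions to tempered
distributions, with the topology of pointwise convergence, that is, of the convergence of all matrix
elements between Schwartz functions. The matrix element `B f g` is the (bilinear) pairing of the
distribution `B f` with the test function `g`. -/
abbrev GenOp (E : Type*) [NormedAddCommGroup E] [NormedSpace ℝ E] := 𝓢(E, ℂ) →Lₚₜ[ℂ] 𝓢'(E, ℂ)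

/-- An operator on Schwartz functions as a generalized operator, through the embedding
`f ↦ (g ↦ ∫ g f)` of Schwartz functions into tempered distributions. -/
def toGenOp {n : ℕ} (L : 𝓢(Config n, ℂ) →L[ℂ] 𝓢(Config n, ℂ)) : GenOp (Config n) :=
  ContinuousLinearMap.toPointwiseConvergenceCLM ℂ (RingHom.id ℂ) _ _
    (SchwartzMap.toTemperedDistributionCLM (Config n) ℂ MeasureTheory.volume ∘L L)

theorem toGenOp_apply {n : ℕ} (L : 𝓢(Config n, ℂ) →L[ℂ] 𝓢(Config n, ℂ))
    (f g : 𝓢(Config n, ℂ)) : toGenOp L f g = ∫ x, g x * L f x :=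
  SchwartzMap.toTemperedDistributionCLM_apply_apply MeasureTheory.volume (L f) g

/-! ### Displacement operators -/

theorem hasTemperateGrowth_cexp_ofReal_mul_I :
    (fun t : ℝ => Complex.exp (t * Complex.I)).HasTemperateGrowth := by
  have hd : ∀ n : ℕ, iteratedDeriv n (fun t : ℝ => Complex.exp (t * Complex.I)) =
      fun t : ℝ => Complex.I ^ n * Complex.exp (t * Complex.I) := by
    intro n
    induction n with
    | zero => simp
    | succ n ih =>
      rw [iteratedDeriv_succ, ih]
      ext t
      have h : HasDerivAt (fun t : ℝ => Complex.I ^ n * Complex.exp (t * Complex.I))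
          (Complex.I ^ n * (Complex.exp (t * Complex.I) * (1 * Complex.I))) t :=
        (((Complex.ofRealCLM.hasDerivAt (x := t)).mul_const Complex.I).cexp).const_mul _
      rw [h.deriv]
      ring
  refine ⟨(Complex.ofRealCLM.contDiff.mul contDiff_const).cexp, fun n => ⟨0, 1, fun t => ?_⟩⟩
  rw [norm_iteratedFDeriv_eq_norm_iteratedDeriv, hd]
  simp [Complex.norm_exp_ofReal_mul_I]

theorem hasTemperateGrowth_phase {n : ℕ} (b : Config n) :
    (fun x : Config n => Complex.exp ((inner ℝ b x : ℝ) * Complex.I)).HasTemperateGrowth :=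
  hasTemperateGrowth_cexp_ofReal_mul_I.comp (f := fun x : Config n => inner ℝ b x) (by fun_prop)

/-- The displacement operator `D(a) = exp(i aᵀ Ω r̂) = exp(i (a_X · p̂ - a_Z · q̂))` on Schwartz
functions, `(D(a) f)(x) = exp(-i a_X · a_Z / 2 - i a_Z · x) f(x + a_X)`. -/
def displacement {n : ℕ} (a : PhaseSpace n) : 𝓢(Config n, ℂ) →L[ℂ] 𝓢(Config n, ℂ) :=
  Complex.exp (-((inner ℝ a.1 a.2 / 2 : ℝ) * Complex.I)) •
    (SchwartzMap.smulLeftCLM ℂ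
        (fun x : Config n => Complex.exp ((inner ℝ (-a.2) x : ℝ) * Complex.I)) ∘L
      SchwartzMap.compSubConstCLM ℂ (-a.1))

theorem displacement_apply {n : ℕ} (a : PhaseSpace n) (f : 𝓢(Config n, ℂ)) (x : Config n) :
    displacement a f x =
      Complex.exp (-((inner ℝ a.1 a.2 / 2 + inner ℝ a.2 x : ℝ) * Complex.I)) * f (x + a.1) := by
  simp only [displacement, _root_.smul_apply, ContinuousLinearMap.comp_apply,
    SchwartzMap.smulLeftCLM_apply_apply (hasTemperateGrowth_phase _),
    SchwartzMap.compSubConstCLM_apply, sub_neg_eq_add, smul_eq_mul]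
  rw [← mul_assoc, ← Complex.exp_add]
  congr 2
  simp only [inner_neg_left]
  push_cast
  ring

/-- The position operator of mode `k`, `(q̂ₖ f)(x) = xₖ f(x)`. -/
def position {n : ℕ} (k : Fin n) : 𝓢(Config n, ℂ) →L[ℂ] 𝓢(Config n, ℂ) :=
  SchwartzMap.smulLeftCLM ℂ (fun x : Config n => (x k : ℂ))

/-- The momentum operator of mode `k`, `p̂ₖ = -i ∂/∂xₖ`. -/
def momentum {n : ℕ} (k : Fin n) : 𝓢(Config n, ℂ) →L[ℂ] 𝓢(Config n, ℂ) :=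
  (-Complex.I) • LineDeriv.lineDerivOpCLM ℂ 𝓢(Config n, ℂ) (EuclideanSpace.single k (1 : ℝ))

/-- The quadrature operator `aᵀ Ω r̂ = ∑ₖ (a_Xₖ p̂ₖ - a_Zₖ q̂ₖ)`, with
`r̂ = (q̂₁, …, q̂ₙ, p̂₁, …, p̂ₙ)`. -/
def quadrature {n : ℕ} (a : PhaseSpace n) : 𝓢(Config n, ℂ) →L[ℂ] 𝓢(Config n, ℂ) :=
  ∑ k, ((a.1 k : ℂ) • momentum k - (a.2 k : ℂ) • position k)

theorem displacement_zero {n : ℕ} :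
    displacement (0 : PhaseSpace n) = ContinuousLinearMap.id ℂ _ := by
  ext f x
  simp [displacement_apply]

/-- `t ↦ D(t a) f` solves `∂ₜ ψ = i (aᵀ Ω r̂) ψ`: this is the sense of `D(a) = exp(i aᵀ Ω r̂)`. -/
theorem hasDerivAt_displacement {n : ℕ} (a : PhaseSpace n) (f : 𝓢(Config n, ℂ)) (x : Config n)
    (t : ℝ) :
    HasDerivAt (fun s : ℝ => displacement (s • a) f x)
      (Complex.I * quadrature a (displacement (t • a) f) x) t := by
  set u := displacement (t • a) f with hu
  have hq : quadrature a u x =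
      -Complex.I * fderiv ℝ u x a.1 - (inner ℝ a.2 x : ℝ) * u x := by
    have h1 : a.1 = ∑ k, a.1 k • EuclideanSpace.single k (1 : ℝ) := by
      ext i
      simp [Finset.sum_apply, Pi.single_apply]
    have hpos : ∀ k, position k u x = x k * u x := fun k =>
      SchwartzMap.smulLeftCLM_apply_apply
        (Complex.ofRealCLM ∘L EuclideanSpace.proj (𝕜 := ℝ) k).hasTemperateGrowth u x
    have hmom : ∀ k, momentum k u x =
        -Complex.I * fderiv ℝ u x (EuclideanSpace.single k (1 : ℝ)) := fun k => rfl
    have hf : fderiv ℝ u x a.1 =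
        ∑ k, (a.1 k : ℂ) * fderiv ℝ u x (EuclideanSpace.single k (1 : ℝ)) := by
      conv_lhs => rw [h1]
      simp
    have hi : ((inner ℝ a.2 x : ℝ) : ℂ) = ∑ k, (a.2 k : ℂ) * (x k : ℂ) := by
      simp [PiLp.inner_apply, mul_comm]
    have hs : quadrature a u x =
        ∑ k, ((a.1 k : ℂ) * momentum k u x - (a.2 k : ℂ) * position k u x) := by
      simp [quadrature, _root_.sum_apply]
    rw [hs, hf, hi, Finset.mul_sum, Finset.sum_mul, ← Finset.sum_sub_distrib]
    refine Finset.sum_congr rfl fun k _ => ?_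
    rw [hpos, hmom]
    ring
  have hline : ∀ y v : Config n, ∀ w : 𝓢(Config n, ℂ), ∀ s : ℝ,
      HasDerivAt (fun r : ℝ => w (y + r • v)) (fderiv ℝ w (y + s • v) v) s := by
    intro y v w s
    have h2 : HasDerivAt (fun r : ℝ => y + r • v) v s := by
      simpa using ((hasDerivAt_id s).smul_const v).const_add y
    exact (w.differentiableAt (x := y + s • v)).hasFDerivAt.comp_hasDerivAt s h2
  have hexp : ∀ (g : ℝ → ℝ) (g' s : ℝ), HasDerivAt g g' s →
      HasDerivAt (fun r : ℝ => Complex.exp (-((g r : ℝ) * Complex.I)))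
        (Complex.exp (-((g s : ℝ) * Complex.I)) * -(g' * Complex.I)) s := fun g g' s hg =>
    ((hg.ofReal_comp.mul_const Complex.I).neg).cexp
  have hfd : fderiv ℝ u x a.1 =
      Complex.exp (-((t * t * inner ℝ a.1 a.2 / 2 + t * inner ℝ a.2 x : ℝ) * Complex.I)) *
        (-((t * inner ℝ a.2 a.1 : ℝ) * Complex.I) * f (x + t • a.1)
          + fderiv ℝ f (x + t • a.1) a.1) := by
    have h3 := hline x a.1 u 0
    have h4 : (fun r : ℝ => u (x + r • a.1)) = fun r : ℝ =>
        Complex.exp (-((t * t * inner ℝ a.1 a.2 / 2 + t * inner ℝ a.2 x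
          + r * (t * inner ℝ a.2 a.1) : ℝ) * Complex.I)) * f ((x + t • a.1) + r • a.1) := by
      ext r
      rw [hu, displacement_apply]
      congr 1
      · congr 4
        simp only [Prod.smul_fst, Prod.smul_snd, inner_smul_left, inner_smul_right, inner_add_right]
        simp
        ring
      · congr 1
        simp only [Prod.smul_fst]
        abel
    rw [h4] at h3
    have h5 : HasDerivAt (fun r : ℝ => t * t * inner ℝ a.1 a.2 / 2 + t * inner ℝ a.2 x
        + r * (t * inner ℝ a.2 a.1)) (t * inner ℝ a.2 a.1) 0 := by
      simpa using ((hasDerivAt_id (0 : ℝ)).mul_const (t * inner ℝ a.2 a.1)).const_add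
          (t * t * inner ℝ a.1 a.2 / 2 + t * inner ℝ a.2 x)
    have h6 := h3.unique ((hexp _ _ _ h5).mul (hline (x + t • a.1) a.1 f 0))
    simp only [zero_smul, add_zero, zero_mul] at h6
    rw [h6]
    ring
  have hux : u x = Complex.exp (-((t * t * inner ℝ a.1 a.2 / 2 + t * inner ℝ a.2 x : ℝ)
      * Complex.I)) * f (x + t • a.1) := by
    rw [hu, displacement_apply]
    congr 4
    simp only [Prod.smul_fst, Prod.smul_snd, inner_smul_left, inner_smul_right]
    simp
    ring
  have hfun : (fun s : ℝ => displacement (s • a) f x) = fun s : ℝ =>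
      Complex.exp (-((s * s * inner ℝ a.1 a.2 / 2 + s * inner ℝ a.2 x : ℝ) * Complex.I))
        * f (x + s • a.1) := by
    ext s
    rw [displacement_apply]
    congr 4
    simp only [Prod.smul_fst, Prod.smul_snd, inner_smul_left, inner_smul_right]
    simp
    ring
  rw [hfun, hq, hfd, hux]
  have h7 : HasDerivAt (fun s : ℝ => s * s * inner ℝ a.1 a.2 / 2 + s * inner ℝ a.2 x)
      (t * inner ℝ a.1 a.2 + inner ℝ a.2 x) t := by
    have h8 := ((((hasDerivAt_id t).mul (hasDerivAt_id t)).mul_const (inner ℝ a.1 a.2)).div_const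
      2).add ((hasDerivAt_id t).mul_const (inner ℝ a.2 x))
    refine h8.congr_deriv ?_
    simp
    ring
  refine ((hexp _ _ t h7).mul (hline x a.1 f t)).congr_deriv ?_
  rw [real_inner_comm a.1 a.2]
  push_cast
  linear_combination (Complex.exp (-((t * t * inner ℝ a.1 a.2 / 2 + t * inner ℝ a.2 x : ℂ)
      * Complex.I)) * (-((t * inner ℝ a.1 a.2 : ℂ) * Complex.I) * f (x + t • a.1)
          + fderiv ℝ f (x + t • a.1) a.1)) * Complex.I_sq

/-- The GKP lattice spacing `ℓ = √(2π/d)`. -/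
def spacing (d : ℕ) : ℝ := Real.sqrt (2 * Real.pi / d)

/-- `T_a = D(-ℓ a)`. -/
def T (d : ℕ) {n : ℕ} (a : PhaseSpace n) : 𝓢(Config n, ℂ) →L[ℂ] 𝓢(Config n, ℂ) :=
  displacement (-(spacing d • a))

/-- The summand `exp(i ℓ [a, η] + i π a_X · a_Z) T_a` of the phase point operator. -/
def phasePointTerm (d : ℕ) {n : ℕ} (η : PhaseSpace n) (a : (Fin n → ℤ) × (Fin n → ℤ)) :
    GenOp (Config n) :=
  Complex.exp (((spacing d * symp (intPhase a) η
      + Real.pi * inner ℝ (intPhase a).1 (intPhase a).2 : ℝ) : ℂ) * Complex.I) •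
    toGenOp (T d (intPhase a))

/-- The Zak-Gross phase point operator
`A_η = (2π)⁻ⁿ ∑_{a ∈ ℤ²ⁿ} exp(i ℓ [a, η] + i π a_X · a_Z) T_a`. -/
def phasePoint (d : ℕ) {n : ℕ} (η : PhaseSpace n) : GenOp (Config n) :=
  (1 / (2 * Real.pi : ℂ) ^ n) • ∑' a : (Fin n → ℤ) × (Fin n → ℤ), phasePointTerm d η a

/-! ### Bras, kets and ideal GKP states -/

section Dirac

variable {E : Type*} [NormedAddCommGroup E] [NormedSpace ℝ E]

/-- Complex conjugation of a Schwartz function. -/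
def conjS (f : 𝓢(E, ℂ)) : 𝓢(E, ℂ) :=
  SchwartzMap.postcompCLM (𝕜 := ℝ) (Complex.conjCLE : ℂ →L[ℝ] ℂ) f

theorem conjS_apply (f : 𝓢(E, ℂ)) (x : E) : conjS f x = (starRingEnd ℂ) (f x) := rfl

/-- The bra `⟨φ|` of a tempered distribution `φ`: `⟨φ|f⟩` is the complex conjugate of `φ(f̄)`. -/
def bra (φ : 𝓢'(E, ℂ)) : 𝓢(E, ℂ) →L[ℂ] ℂ where
  toFun f := (starRingEnd ℂ) (φ (conjS f))
  map_add' f g := by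
    have h : conjS (f + g) = conjS f + conjS g := map_add _ f g
    rw [h, map_add, map_add]
  map_smul' c f := by
    have h : conjS (c • f) = (starRingEnd ℂ) c • conjS f := by
      ext x
      simp [conjS_apply]
    simp [h]
  cont := Complex.continuous_conj.comp (φ.continuous.comp
    (SchwartzMap.postcompCLM (𝕜 := ℝ) (Complex.conjCLE : ℂ →L[ℝ] ℂ)).continuous)

/-- The generalized operator `|ψ⟩⟨φ|`, `f ↦ ⟨φ|f⟩ ψ`. -/
def ketBra (ψ φ : 𝓢'(E, ℂ)) : GenOp E where
  toFun f := bra φ f • ψ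
  map_add' f g := by
    ext g
    simp [add_mul]
  map_smul' c f := by
    ext g
    simp [mul_assoc]
  cont := PointwiseConvergenceCLM.continuous_of_continuous_eval fun g =>
    (bra φ).continuous.mul continuous_const

theorem ketBra_apply (ψ φ : 𝓢'(E, ℂ)) (f g : 𝓢(E, ℂ)) :
    ketBra ψ φ f g = (starRingEnd ℂ) (φ (conjS f)) * ψ g := rfl

/-- The position eigenket `|x⟩`. -/
def positionKet (x : E) : 𝓢'(E, ℂ) := TemperedDistribution.delta x

/-- A sum of position eigenkets over points of polynomial density converges to a tempered
distribution. -/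
theorem hasSum_positionKet {ι : Type*} (x : ι → E) (k : ℕ)
    (hx : Summable fun i => ((1 + ‖x i‖) ^ k)⁻¹) (f : 𝓢(E, ℂ)) :
    Summable (fun i => positionKet (x i)) ∧ Summable (fun i => ‖f (x i)‖) ∧
      (∑' i, positionKet (x i)) f = ∑' i, f (x i) := by
  have hb : ∀ (g : 𝓢(E, ℂ)) i, ‖g (x i)‖ ≤
      2 ^ k * (Finset.Iic (k, 0)).sup (schwartzSeminormFamily ℂ E ℂ) g * ((1 + ‖x i‖) ^ k)⁻¹ := by
    intro g i
    have h := SchwartzMap.one_add_le_sup_seminorm_apply (𝕜 := ℂ) (m := (k, 0)) (le_refl k)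
      (le_refl 0) g (x i)
    rw [norm_iteratedFDeriv_zero] at h
    rw [← div_eq_mul_inv, le_div_iff₀ (by positivity), mul_comm]
    exact h
  have hs : ∀ g : 𝓢(E, ℂ), Summable fun i => ‖g (x i)‖ := fun g =>
    Summable.of_nonneg_of_le (fun _ => norm_nonneg _) (hb g) (hx.mul_left _)
  let φ : 𝓢(E, ℂ) →L[ℂ] ℂ := SchwartzMap.mkCLMtoNormedSpace (fun g => ∑' i, g (x i))
    (fun g h => (hs g).of_norm.tsum_add (hs h).of_norm)
    (fun c g => tsum_mul_left)
    ⟨Finset.Iic (k, 0), 2 ^ k * ∑' i, ((1 + ‖x i‖) ^ k)⁻¹,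
      mul_nonneg (by positivity) (tsum_nonneg fun _ => by positivity), fun g => by
      refine (norm_tsum_le_tsum_norm (hs g)).trans (((hs g).tsum_le_tsum (hb g)
        (hx.mul_left _)).trans (le_of_eq ?_))
      rw [tsum_mul_left]
      ring⟩
  let φ' : 𝓢'(E, ℂ) := ContinuousLinearMap.toPointwiseConvergenceCLM ℂ (RingHom.id ℂ) _ _ φ
  have hφ : HasSum (fun i => positionKet (x i)) φ' := by
    unfold HasSum
    rw [PointwiseConvergenceCLM.tendsto_iff_forall_tendsto]
    intro g
    have h := (hs g).of_norm.hasSum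
    unfold HasSum at h
    refine h.congr fun s => ?_
    simp [positionKet]
  refine ⟨hφ.summable, hs f, ?_⟩
  rw [hφ.tsum_eq]
  rfl

end Dirac

theorem hasSum_prod_pi {n : ℕ} (f : Fin n → ℤ → ℂ) (hf : ∀ k, Summable fun m => ‖f k m‖) :
    Summable (fun m : Fin n → ℤ => ‖∏ k, f k (m k)‖) ∧
      ∑' m : Fin n → ℤ, ∏ k, f k (m k) = ∏ k, ∑' m, f k m := by
  induction n with
  | zero => simp [Summable.of_finite]
  | succ n ih =>
    obtain ⟨h1, h2⟩ := ih (fun k => f k.succ) fun k => hf k.succ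
    let e := Fin.consEquiv fun _ : Fin (n + 1) => ℤ
    have h3 : ∀ p : ℤ × (Fin n → ℤ), ∏ k, f k (e p k) =
        f 0 p.1 * ∏ k : Fin n, f k.succ (p.2 k) := fun p => by
      simp [e, Fin.prod_univ_succ, Fin.consEquiv]
    constructor
    · rw [← e.summable_iff]
      refine ((hf 0).mul_norm h1).congr fun p => ?_
      simp only [Function.comp_apply, h3]
    · rw [← e.tsum_eq, Fin.prod_univ_succ, ← h2, tsum_mul_tsum_of_summable_norm (hf 0) h1]
      exact tsum_congr h3

theorem spacing_pos {d : ℕ} (hd : d ≠ 0) : 0 < spacing d := by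
  unfold spacing
  positivity

theorem summable_comb {d : ℕ} (hd : d ≠ 0) (j : ℤ) :
    Summable fun m : ℤ => ((1 + ‖((d * m + j : ℤ) : ℝ) * spacing d‖) ^ 2)⁻¹ := by
  have hl := spacing_pos hd
  have hd' : (0 : ℝ) < d := by positivity
  have h := ((Real.summable_one_div_int_add_rpow ((j : ℝ) / d) 2).2 (by norm_num)).mul_left
    (((spacing d * d) ^ 2)⁻¹)
  refine h.of_norm_bounded_eventually (Set.Finite.subset (Set.finite_le_nat 0 |>.image
    fun _ => (-j) / (d : ℤ)) fun m hm => ?_)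
  have h0 : (m : ℝ) + (j : ℝ) / d = 0 := by
    by_contra h0
    apply hm
    have h1 : 0 < |(m : ℝ) + (j : ℝ) / d| := abs_pos.2 h0
    have h2 : spacing d * d * |(m : ℝ) + (j : ℝ) / d| = ‖((d * m + j : ℤ) : ℝ) * spacing d‖ := by
      rw [Real.norm_eq_abs, abs_mul, abs_of_pos hl, ← abs_of_pos hd', mul_assoc, ← abs_mul,
        abs_of_pos hd', mul_comm]
      congr 2
      push_cast
      field_simp
    rw [Set.mem_ofPred_eq, Real.norm_of_nonneg (by positivity), one_div, ← mul_inv,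
      Real.rpow_ofNat, ← mul_pow, h2]
    have h3 : 0 < ‖((d * m + j : ℤ) : ℝ) * spacing d‖ := by rw [← h2]; positivity
    gcongr
    linarith
  refine ⟨0, by simp, ?_⟩
  have h1 : (d : ℤ) * m = -j := by
    field_simp at h0
    have : (d : ℝ) * m = -j := by linarith
    exact_mod_cast this
  show (-j) / (d : ℤ) = m
  rw [← h1]
  exact Int.mul_ediv_cancel_left _ (by exact_mod_cast hd)


/-- The ideal one-mode GKP state `|j_GKP⟩ = ℓ^(-1/2) ∑ₘ |(d m + j) ℓ⟩`, for any integer `j` (it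
depends on `j` modulo `d` only). -/
def gkpKet (d : ℕ) (j : ℤ) : 𝓢'(ℝ, ℂ) :=
  (1 / Real.sqrt (spacing d) : ℂ) •
    ∑' m : ℤ, positionKet (((d * m + j : ℤ) : ℝ) * spacing d)

/-- The one-mode logical parity operator `∑_{j = 0}^{d-1} |-j_GKP⟩⟨j_GKP|`. -/
def logicalParityOne (d : ℕ) : GenOp ℝ :=
  ∑ j : Fin d, ketBra (gkpKet d (-(j : ℤ))) (gkpKet d (j : ℤ))

/-- The `n`-mode product state `|j₁_GKP⟩ ⊗ ⋯ ⊗ |jₙ_GKP⟩`, with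
`|x₁⟩ ⊗ ⋯ ⊗ |xₙ⟩ = |(x₁, …, xₙ)⟩`. -/
def gkpKetMulti (d : ℕ) {n : ℕ} (j : Fin n → ℤ) : 𝓢'(Config n, ℂ) :=
  (1 / Real.sqrt (spacing d) : ℂ) ^ n •
    ∑' m : Fin n → ℤ, positionKet (spacing d • intVec fun k => d * m k + j k)

theorem gkpKet_apply {d : ℕ} (hd : d ≠ 0) (j : ℤ) (f : 𝓢(ℝ, ℂ)) :
    gkpKet d j f = (1 / Real.sqrt (spacing d) : ℂ) *
      ∑' m : ℤ, f (((d * m + j : ℤ) : ℝ) * spacing d) := by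
  obtain ⟨h1, -, h3⟩ := hasSum_positionKet _ 2 (summable_comb hd j) f
  rw [← h3]
  rfl

theorem summable_combMulti {d n : ℕ} (hd : d ≠ 0) (j : Fin n → ℤ) :
    Summable fun m : Fin n → ℤ =>
      ((1 + ‖spacing d • intVec fun k => d * m k + j k‖) ^ (2 * n))⁻¹ := by
  have h3 : ∀ (k : Fin n) (m : ℤ),
      ‖((((1 + ‖((d * m + j k : ℤ) : ℝ) * spacing d‖) ^ 2)⁻¹ : ℝ) : ℂ)‖ =
        ((1 + ‖((d * m + j k : ℤ) : ℝ) * spacing d‖) ^ 2)⁻¹ := fun k m => by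
    rw [Complex.norm_real, Real.norm_of_nonneg (by positivity)]
  have h := (hasSum_prod_pi (fun (k : Fin n) (m : ℤ) =>
    ((((1 + ‖((d * m + j k : ℤ) : ℝ) * spacing d‖) ^ 2)⁻¹ : ℝ) : ℂ)) (fun k =>
      (summable_comb hd (j k)).congr fun m => (h3 k m).symm)).1
  refine Summable.of_nonneg_of_le (fun _ => by positivity) (fun m => ?_) h
  have h1 : ∀ k : Fin n, ‖((d * m k + j k : ℤ) : ℝ) * spacing d‖ ≤
      ‖spacing d • intVec fun k => d * m k + j k‖ := fun k => by
    have h2 := PiLp.norm_apply_le (spacing d • intVec fun k => d * m k + j k) k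
    simpa [intVec, mul_comm] using h2
  rw [norm_prod, pow_mul]
  simp only [h3, Finset.prod_inv_distrib]
  refine inv_anti₀ (Finset.prod_pos fun k _ => by positivity) ?_
  calc _ ≤ ∏ _k : Fin n, (1 + ‖spacing d • intVec fun k => d * m k + j k‖) ^ 2 :=
        Finset.prod_le_prod (fun k _ => by positivity) fun k _ => by
          gcongr
          exact h1 k
    _ = _ := by simp

theorem gkpKetMulti_apply {d n : ℕ} (hd : d ≠ 0) (j : Fin n → ℤ) (f : 𝓢(Config n, ℂ)) :
    gkpKetMulti d j f = (1 / Real.sqrt (spacing d) : ℂ) ^ n *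
      ∑' m : Fin n → ℤ, f (spacing d • intVec fun k => d * m k + j k) := by
  obtain ⟨h1, -, h3⟩ := hasSum_positionKet _ _ (summable_combMulti hd j) f
  rw [← h3]
  rfl

theorem gkpKetMulti_prod {d n : ℕ} (hd : d ≠ 0) (j : Fin n → ℤ) (f : Fin n → 𝓢(ℝ, ℂ))
    (F : 𝓢(Config n, ℂ)) (hF : ∀ x, F x = ∏ k, f k (x k)) :
    gkpKetMulti d j F = ∏ k, gkpKet d (j k) (f k) := by
  simp only [gkpKetMulti_apply hd, gkpKet_apply hd, hF, Finset.prod_mul_distrib]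
  rw [← (hasSum_prod_pi _ fun k => (hasSum_positionKet _ 2 (summable_comb hd (j k)) (f k)).2.1).2]
  simp [intVec, mul_comm]

/-- The logical parity operator `Π_d^L = (∑ⱼ |-j_GKP⟩⟨j_GKP|)^{⊗ n}`, with the tensor power expanded
over `j ∈ {0, …, d-1}ⁿ`. -/
def logicalParity (d n : ℕ) : GenOp (Config n) :=
  ∑ j : Fin n → Fin d,
    ketBra (gkpKetMulti d fun k => -(j k : ℤ)) (gkpKetMulti d fun k => (j k : ℤ))

/-- `B` is the `n`-fold tensor power of `b`: on product functions the matrix elements of `B` are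
the products of those of `b`. (Product functions span a dense subspace, so this determines `B`.) -/
def IsTensorPower {n : ℕ} (b : GenOp ℝ) (B : GenOp (Config n)) : Prop :=
  ∀ (f g : Fin n → 𝓢(ℝ, ℂ)) (F G : 𝓢(Config n, ℂ)),
    (∀ x, F x = ∏ k, f k (x k)) → (∀ x, G x = ∏ k, g k (x k)) → B F G = ∏ k, b (f k) (g k)

theorem isTensorPower_logicalParity {d : ℕ} (hd : d ≠ 0) (n : ℕ) :
    IsTensorPower (logicalParityOne d) (logicalParity d n) := by
  intro f g F G hF hG
  have hc : ∀ x, conjS F x = ∏ k, conjS (f k) (x k) := fun x => by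
    simp [conjS_apply, hF, map_prod]
  have h1 : ∀ (f g : 𝓢(ℝ, ℂ)), logicalParityOne d f g =
      ∑ j : Fin d, ketBra (gkpKet d (-(j : ℤ))) (gkpKet d (j : ℤ)) f g := fun f g => by
    simp [logicalParityOne]
  have h2 : logicalParity d n F G = ∑ j : Fin n → Fin d,
      ketBra (gkpKetMulti d fun k => -(j k : ℤ)) (gkpKetMulti d fun k => (j k : ℤ)) F G := by
    simp [logicalParity]
  simp only [h1, h2, Finset.prod_univ_sum, Fintype.piFinset_univ, ketBra_apply,
    gkpKetMulti_prod hd _ _ _ hc, gkpKetMulti_prod hd _ _ _ hG, map_prod, Finset.prod_mul_distrib]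

end GKP

end

open scoped SchwartzMap

noncomputable section

open MeasureTheory FourierTransform

namespace GKP


/-! Write `ℓ` for the spacing, so that `d ℓ² = 2π`, and `d = 2r + 1`. The matrix element of the
summand at `(p, q)` between `f` and `g` is the integral of `g(x) f(x - ℓp)` against a phase. Since
`π - π/d = ℓ² r`, the sign `exp(iπ p·q)` and the half-phase of the displacement combine into the
pure character `exp(iℓ q·(x + ℓ r p))`. After the substitution `x + ℓ r p = dℓ y` this is `exp(2πi
q·y)`, so Poisson summation over `q` gives `(dℓ)ⁿ ∑ₖ g(ℓu) f(ℓv)` with `u = dk - rp` and `v = u -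
p`.

As `(p, k)` runs over `ℤ²ⁿ`, `(u, v)` runs exactly once over the integer pairs with `u + v ≡ 0`
modulo `d` in each mode, that is `v = dm' + j`, `u = dm - j` with `0 ≤ j < d`. Sorting by `j` yields
the matrix element of the logical parity, and `(dℓ)ⁿ = (2π)ⁿ ℓ⁻ⁿ` accounts for the normalization.

The rearrangements rest on absolute summability (`summable_norm_toGenOp_T`); the other main
ingredients are `tsum_integral_exp_mul_schwartz_eq`, `phasePointTerm_zero_apply_eq_integral` and
`latticeEquiv`. -/

/-! ### Decay and absolute summability of displacement matrix elements -/

theorem one_add_norm_le_mul {E : Type*} [NormedAddCommGroup E] (x y : E) :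
    1 + ‖y‖ ≤ (1 + ‖x‖) * (1 + ‖x - y‖) := by
  have h : ‖y‖ ≤ ‖x‖ + ‖x - y‖ := by simpa using norm_sub_le x (x - y)
  nlinarith [mul_nonneg (norm_nonneg x) (norm_nonneg (x - y))]

theorem exists_norm_le_inv_one_add_norm_pow {E : Type*} [NormedAddCommGroup E] [NormedSpace ℝ E]
    (f : 𝓢(E, ℂ)) (N : ℕ) :
    ∃ C, 0 ≤ C ∧ ∀ x, ‖f x‖ ≤ C * ((1 + ‖x‖) ^ N)⁻¹ := by
  refine ⟨2 ^ N * (Finset.Iic (N, 0)).sup (schwartzSeminormFamily ℂ E ℂ) f,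
    mul_nonneg (by positivity) (apply_nonneg _ _), fun x => ?_⟩
  have h := SchwartzMap.one_add_le_sup_seminorm_apply (𝕜 := ℂ) (m := (N, 0)) (le_refl N)
    (le_refl 0) f x
  rw [norm_iteratedFDeriv_zero] at h
  rw [← div_eq_mul_inv, le_div_iff₀ (by positivity), mul_comm]
  exact h

/-- The integral of `|g|` against a translate of `|f|` decays rapidly in the translation. -/
theorem exists_integral_norm_mul_translate_le {n : ℕ} (g f : 𝓢(Config n, ℂ)) (N : ℕ) :
    ∃ C, 0 ≤ C ∧ ∀ c, ∫ x, ‖g x‖ * ‖f (x - c)‖ ≤ C * ((1 + ‖c‖) ^ N)⁻¹ := by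
  -- The `n + 1` extra powers make the integral over `ℝⁿ` converge; the other `N` are traded,
  -- together with the decay of `f`, for decay in `c`.
  obtain ⟨A, hA, hg⟩ := exists_norm_le_inv_one_add_norm_pow g (N + (n + 1))
  obtain ⟨B, hB, hf⟩ := exists_norm_le_inv_one_add_norm_pow f N
  have hint : Integrable fun x : Config n => ((1 + ‖x‖) ^ (n + 1))⁻¹ := by
    have h := integrable_one_add_norm (E := Config n) (μ := volume) (r := (n + 1 : ℕ)) (by simp)
    refine h.congr (.of_forall fun x => ?_)
    simp only [Real.rpow_neg (by positivity : (0 : ℝ) ≤ 1 + ‖x‖), Real.rpow_natCast]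
  refine ⟨A * B * ∫ x : Config n, ((1 + ‖x‖) ^ (n + 1))⁻¹,
    mul_nonneg (by positivity) (integral_nonneg fun x => by positivity), fun c => ?_⟩
  rw [mul_right_comm, ← integral_const_mul]
  refine integral_mono_of_nonneg (.of_forall fun x => by positivity) (hint.const_mul _)
    (.of_forall fun x => ?_)
  have h1 : (1 + ‖c‖) ^ N ≤ (1 + ‖x‖) ^ N * (1 + ‖x - c‖) ^ N := by
    rw [← mul_pow]
    gcongr
    exact one_add_norm_le_mul x c
  calc ‖g x‖ * ‖f (x - c)‖
      ≤ (A * ((1 + ‖x‖) ^ (N + (n + 1)))⁻¹) * (B * ((1 + ‖x - c‖) ^ N)⁻¹) := by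
        gcongr
        · exact hg x
        · exact hf _
    _ = A * B * ((1 + ‖x‖) ^ N * (1 + ‖x - c‖) ^ N)⁻¹ * ((1 + ‖x‖) ^ (n + 1))⁻¹ := by
        rw [pow_add, mul_inv, mul_inv]; ring
    _ ≤ A * B * ((1 + ‖c‖) ^ N)⁻¹ * ((1 + ‖x‖) ^ (n + 1))⁻¹ := by gcongr

/-- The norm dominates every coordinate, so the power `2n` dominates a product of `n`
one-dimensional factors, each squared and hence summable over `ℤ`. -/
theorem summable_inv_one_add_norm_intVec {n : ℕ} {c : ℝ} (hc : 0 < c) :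
    Summable fun m : Fin n → ℤ => ((1 + ‖c • intVec m‖) ^ (2 * n))⁻¹ := by
  have h1 : Summable fun m : ℤ => ((1 + c * |(m : ℝ)|) ^ 2)⁻¹ := by
    have h := ((Real.summable_one_div_int_pow (p := 2)).2 (by norm_num)).mul_left ((c ^ 2)⁻¹)
    refine h.of_norm_bounded_eventually ((Set.finite_singleton (0 : ℤ)).subset fun m hm => ?_)
    by_contra h0
    have h0' : 0 < |(m : ℝ)| := abs_pos.2 (by exact_mod_cast h0)
    apply hm
    rw [Set.mem_ofPred_eq, Real.norm_of_nonneg (by positivity), one_div, ← mul_inv, ← sq_abs (m : ℝ), ← mul_pow]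
    gcongr
    linarith
  have h3 : ∀ m : ℤ, ‖((((1 + c * |(m : ℝ)|) ^ 2)⁻¹ : ℝ) : ℂ)‖ = ((1 + c * |(m : ℝ)|) ^ 2)⁻¹ :=
    fun m => by rw [Complex.norm_real, Real.norm_of_nonneg (by positivity)]
  have h := (hasSum_prod_pi (fun (_ : Fin n) (m : ℤ) =>
    ((((1 + c * |(m : ℝ)|) ^ 2)⁻¹ : ℝ) : ℂ)) (fun _ => h1.congr fun m => (h3 m).symm)).1
  refine Summable.of_nonneg_of_le (fun _ => by positivity) (fun m => ?_) h
  have h4 : ∀ k : Fin n, c * |(m k : ℝ)| ≤ ‖c • intVec m‖ := fun k => by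
    have h2 := PiLp.norm_apply_le (c • intVec m) k
    simpa [intVec, abs_mul, abs_of_pos hc] using h2
  rw [norm_prod, pow_mul]
  simp only [h3, Finset.prod_inv_distrib]
  refine inv_anti₀ (Finset.prod_pos fun k _ => by positivity) ?_
  calc _ ≤ ∏ _k : Fin n, (1 + ‖c • intVec m‖) ^ 2 :=
        Finset.prod_le_prod (fun k _ => by positivity) fun k _ => by
          gcongr
          exact h4 k
    _ = _ := by simp

theorem T_apply (d : ℕ) {n : ℕ} (a : PhaseSpace n) (f : 𝓢(Config n, ℂ)) (x : Config n) :
    T d a f x = Complex.exp ((spacing d * inner ℝ a.2 x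
      - spacing d ^ 2 / 2 * inner ℝ a.1 a.2 : ℝ) * Complex.I) * f (x - spacing d • a.1) := by
  rw [T, displacement_apply]
  congr 2
  simp only [Prod.fst_neg, Prod.snd_neg, Prod.smul_fst, Prod.smul_snd, inner_neg_left,
    inner_neg_right, real_inner_smul_left, real_inner_smul_right]
  push_cast
  ring

theorem norm_T_apply (d : ℕ) {n : ℕ} (a : PhaseSpace n) (f : 𝓢(Config n, ℂ)) (x : Config n) :
    ‖T d a f x‖ = ‖f (x - spacing d • a.1)‖ := by
  rw [T_apply, norm_mul, Complex.norm_exp_ofReal_mul_I, one_mul]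

/-- The Fourier transform exchanges translation and modulation, so `a.2` becomes a translation up to
a unimodular factor. The `2π` in the shift comes from the kernel `exp(-2πi x·ξ)`. -/
theorem norm_fourier_T_apply (d : ℕ) {n : ℕ} (a : PhaseSpace n) (f : 𝓢(Config n, ℂ))
    (ξ : Config n) :
    ‖𝓕 (T d a f) ξ‖ = ‖𝓕 f (ξ - (spacing d / (2 * Real.pi)) • a.2)‖ := by
  rw [SchwartzMap.fourier_coe, SchwartzMap.fourier_coe, Real.fourier_eq', Real.fourier_eq',
    ← integral_add_right_eq_self _ (spacing d • a.1)]
  have h : ∀ v : Config n,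
      Complex.exp (↑(-2 * Real.pi * inner ℝ (v + spacing d • a.1) ξ) * Complex.I) •
        T d a f (v + spacing d • a.1) =
      Complex.exp ((spacing d ^ 2 / 2 * inner ℝ a.1 a.2
        - 2 * Real.pi * spacing d * inner ℝ a.1 ξ : ℝ) * Complex.I) *
      (Complex.exp (↑(-2 * Real.pi * inner ℝ v (ξ - (spacing d / (2 * Real.pi)) • a.2))
        * Complex.I) • f v) := by
    intro v
    rw [T_apply, smul_eq_mul, smul_eq_mul, ← mul_assoc, ← mul_assoc, ← Complex.exp_add,
      ← Complex.exp_add, add_sub_cancel_right, ← add_mul, ← add_mul, ← Complex.ofReal_add,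
      ← Complex.ofReal_add]
    congr 4
    simp only [inner_add_left, inner_add_right, inner_sub_right, real_inner_smul_left,
      real_inner_smul_right, real_inner_comm v a.2, real_inner_comm a.1 a.2]
    field_simp
    ring
  simp_rw [h]
  rw [integral_const_mul, norm_mul, Complex.norm_exp_ofReal_mul_I, one_mul]

/-- Matrix elements of the displacement operators are absolutely summable over the lattice. -/
theorem summable_norm_toGenOp_T {d : ℕ} (hd : d ≠ 0) {n : ℕ} (f g : 𝓢(Config n, ℂ)) :
    Summable fun a : (Fin n → ℤ) × (Fin n → ℤ) => ‖toGenOp (T d (intPhase a)) f g‖ := by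
  have hl := spacing_pos hd
  -- The exponent `4n` is halved by the geometric mean below, which leaves the summable exponent
  -- `2n` in each of the two lattice variables.
  obtain ⟨A, hA, h1⟩ := exists_integral_norm_mul_translate_le g f (2 * n * 2)
  obtain ⟨B, hB, h2⟩ := exists_integral_norm_mul_translate_le (𝓕⁻ g) (𝓕 f) (2 * n * 2)
  have hs := ((summable_inv_one_add_norm_intVec (n := n) hl).mul_of_nonneg
    (summable_inv_one_add_norm_intVec (n := n) (div_pos hl Real.two_pi_pos))
    (fun _ => by positivity) (fun _ => by positivity)).mul_left (Real.sqrt (A * B))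
  refine Summable.of_nonneg_of_le (fun _ => norm_nonneg _) (fun a => ?_) hs
  set w := toGenOp (T d (intPhase a)) f g with hw
  have hX : ‖w‖ ≤ A * ((1 + ‖spacing d • intVec a.1‖) ^ (2 * n * 2))⁻¹ := by
    refine le_trans ?_ (h1 _)
    rw [hw, toGenOp_apply]
    refine (norm_integral_le_integral_norm _).trans_eq (integral_congr_ae (.of_forall fun x => ?_))
    simp only [norm_mul, norm_T_apply]
    rfl
  have hZ : ‖w‖ ≤ B * ((1 + ‖(spacing d / (2 * Real.pi)) • intVec a.2‖) ^ (2 * n * 2))⁻¹ := by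
    refine le_trans ?_ (h2 _)
    -- Moving the pairing to the Fourier side turns the modulation into a translation, which is what
    -- produces decay in `a.2`.
    have h3 : w = ∫ ξ, (𝓕⁻ g) ξ * (𝓕 (T d (intPhase a) f)) ξ := by
      rw [hw, toGenOp_apply, ← SchwartzMap.integral_fourier_mul_eq,
        FourierTransform.fourier_fourierInv_eq]
    rw [h3]
    refine (norm_integral_le_integral_norm _).trans_eq (integral_congr_ae (.of_forall fun x => ?_))
    simp only [norm_mul, norm_fourier_T_apply]
    rfl
  -- Each bound controls only one of the two variables; their geometric mean controls both.
  refine abs_le_of_sq_le_sq' ?_ (by positivity) |>.2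
  rw [mul_pow, Real.sq_sqrt (by positivity), mul_pow, inv_pow, inv_pow, ← pow_mul, ← pow_mul, sq]
  refine (mul_le_mul hX hZ (norm_nonneg _) (by positivity)).trans_eq ?_
  ring


/-! ### Poisson summation on `ℝⁿ` -/

/-- The half-open unit cube with corner `m`. -/
def unitCube {n : ℕ} (m : Fin n → ℤ) : Set (Fin n → ℝ) :=
  {x | ∀ i, x i ∈ Set.Ioc (m i : ℝ) (m i + 1)}

theorem mem_unitCube_iff {n : ℕ} {m : Fin n → ℤ} {x : Fin n → ℝ} :
    x ∈ unitCube m ↔ m = fun i => ⌈x i⌉ - 1 := by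
  simp only [unitCube, Set.mem_ofPred_eq, Set.mem_Ioc, funext_iff]
  refine forall_congr' fun i => ?_
  rw [eq_sub_iff_add_eq, eq_comm, Int.ceil_eq_iff]
  push_cast
  simp

theorem measurableSet_unitCube {n : ℕ} (m : Fin n → ℤ) : MeasurableSet (unitCube m) :=
  MeasurableSet.univ_pi' fun _ => measurableSet_Ioc

theorem setIntegral_unitCube {n : ℕ} {E : Type*} [NormedAddCommGroup E] [NormedSpace ℝ E]
    (f : (Fin n → ℝ) → E) (m : Fin n → ℤ) :
    ∫ x in unitCube m, f x = ∫ x in unitCube (0 : Fin n → ℤ), f (x + fun i => (m i : ℝ)) := by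
  rw [← (measurePreserving_add_right volume fun i => (m i : ℝ)).setIntegral_preimage_emb
    (measurableEmbedding_addRight _)]
  congr 2
  ext x
  simp [unitCube, add_comm (x _)]

/-- Integration over the whole space by integration over the translates of the unit cube. -/
theorem hasSum_setIntegral_unitCube {n : ℕ} {E : Type*} [NormedAddCommGroup E] [NormedSpace ℝ E]
    {f : (Fin n → ℝ) → E} (hf : Integrable f) :
    HasSum (fun m : Fin n → ℤ => ∫ x in unitCube (0 : Fin n → ℤ), f (x + fun i => (m i : ℝ)))
      (∫ x, f x) := by
  have hU : (⋃ m : Fin n → ℤ, unitCube m) = Set.univ :=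
    Set.eq_univ_of_forall fun x => Set.mem_iUnion.2 ⟨_, mem_unitCube_iff.2 rfl⟩
  have h := hasSum_integral_iUnion (μ := volume) (f := f) (fun m => measurableSet_unitCube m)
    (fun m m' hmm => Set.disjoint_left.2 fun x hx hx' =>
      hmm ((mem_unitCube_iff.1 hx).trans (mem_unitCube_iff.1 hx').symm)) (hU ▸ hf.integrableOn)
  rw [hU, setIntegral_univ] at h
  exact h.congr_fun fun m => (setIntegral_unitCube f m).symm

/-- The sum of all integer translates of `f`. -/
def periodization {n : ℕ} (f : (Fin n → ℝ) → ℂ) (x : Fin n → ℝ) : ℂ :=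
  ∑' m : Fin n → ℤ, f (x + fun i => (m i : ℝ))

theorem periodization_add_int {n : ℕ} (f : (Fin n → ℝ) → ℂ) (x : Fin n → ℝ) (k : Fin n → ℤ) :
    periodization f (x + fun i => (k i : ℝ)) = periodization f x := by
  unfold periodization
  rw [← (Equiv.addLeft k).tsum_eq fun m : Fin n → ℤ => f (x + fun i => (m i : ℝ))]
  refine tsum_congr fun m => ?_
  congr 1
  ext i
  simp [add_assoc]

/-- Weierstrass M-test near each point: a continuous `K` is locally bounded, so the series converges
uniformly there. -/
theorem continuous_periodization {n : ℕ} {f : (Fin n → ℝ) → ℂ} (hf : Continuous f)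
    {K : (Fin n → ℝ) → ℝ} (hK : Continuous K) {u : (Fin n → ℤ) → ℝ} (hu : Summable u)
    (hb : ∀ x m, ‖f (x + fun i => (m i : ℝ))‖ ≤ K x * u m) :
    Continuous (periodization f) := by
  refine continuous_iff_continuousAt.2 fun x₀ => ?_
  have hU : IsOpen {x | |K x| < |K x₀| + 1} := isOpen_lt hK.abs continuous_const
  have h : ContinuousOn (periodization f) {x | |K x| < |K x₀| + 1} := by
    refine continuousOn_tsum (u := fun m => (|K x₀| + 1) * |u m|)
      (fun m => (hf.comp (continuous_id.add continuous_const)).continuousOn)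
      (hu.abs.mul_left _) fun m x hx => (hb x m).trans ?_
    rw [Set.mem_ofPred_eq] at hx
    refine (le_abs_self _).trans ?_
    rw [abs_mul]
    gcongr
  exact h.continuousAt (hU.mem_nhds (lt_add_one |K x₀|))

/-- A function on the torus from a function on `ℝⁿ`, by restriction to the unit cube. -/
def torusFun {n : ℕ} (P : (Fin n → ℝ) → ℂ) (t : UnitAddTorus (Fin n)) : ℂ :=
  P fun i => (AddCircle.equivIoc 1 0 (t i) : ℝ)

theorem torusFun_coe {n : ℕ} {P : (Fin n → ℝ) → ℂ}
    (hP : ∀ x (k : Fin n → ℤ), P (x + fun i => (k i : ℝ)) = P x) (x : Fin n → ℝ) :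
    torusFun P (fun i => (x i : UnitAddCircle)) = P x := by
  unfold torusFun
  have h : ∀ i, ∃ k : ℤ, (AddCircle.equivIoc 1 0 (x i : UnitAddCircle) : ℝ) = x i + k := by
    intro i
    have h1 : ((AddCircle.equivIoc 1 0 (x i : UnitAddCircle) : ℝ) : UnitAddCircle) = x i :=
      (AddCircle.equivIoc (1 : ℝ) 0).symm_apply_apply _
    rw [← sub_eq_zero, ← AddCircle.coe_sub, AddCircle.coe_eq_zero_iff] at h1
    obtain ⟨k, hk⟩ := h1
    exact ⟨k, by rw [zsmul_one] at hk; linarith⟩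
  choose k hk using h
  rw [← hP x k]
  congr 1
  ext i
  exact hk i

/-- Restriction to a cube hides continuity across its faces. It is recovered by pulling back along
the quotient map from `ℝⁿ` to the torus, where periodicity gives `P` itself. -/
theorem continuous_torusFun {n : ℕ} {P : (Fin n → ℝ) → ℂ} (hc : Continuous P)
    (hP : ∀ x (k : Fin n → ℤ), P (x + fun i => (k i : ℝ)) = P x) : Continuous (torusFun P) := by
  have hq : IsOpenQuotientMap (Pi.map fun (_ : Fin n) (x : ℝ) => (x : UnitAddCircle)) :=
    IsOpenQuotientMap.piMap fun _ => QuotientAddGroup.isOpenQuotientMap_mk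
  rw [hq.isQuotientMap.continuous_iff]
  convert hc using 1
  ext x
  exact torusFun_coe hP x

theorem mFourier_neg_coe {n : ℕ} (q : Fin n → ℤ) (x : Fin n → ℝ) :
    UnitAddTorus.mFourier (-q) (fun i => (x i : UnitAddCircle)) =
      Complex.exp (-(2 * Real.pi * ∑ i, (q i : ℝ) * x i : ℝ) * Complex.I) := by
  simp only [UnitAddTorus.mFourier, ContinuousMap.coe_mk, fourier_coe_apply, ← Complex.exp_sum]
  congr 1
  push_cast
  rw [Finset.mul_sum, ← Finset.sum_neg_distrib, Finset.sum_mul]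
  refine Finset.sum_congr rfl fun i _ => ?_
  simp only [Pi.neg_apply]
  push_cast
  ring

/-- Unfolding: the character is invariant under integer shifts, so it passes inside the
periodization, and integrating the sum over one cube is integrating over all of `ℝⁿ`. -/
theorem mFourierCoeff_periodization {n : ℕ} {f : (Fin n → ℝ) → ℂ} (hi : Integrable f)
    (q : Fin n → ℤ) :
    UnitAddTorus.mFourierCoeff (torusFun (periodization f)) q =
      ∫ x, Complex.exp (-(2 * Real.pi * ∑ i, (q i : ℝ) * x i : ℝ) * Complex.I) * f x := by
  set g : (Fin n → ℝ) → ℂ :=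
    fun x => Complex.exp (-(2 * Real.pi * ∑ i, (q i : ℝ) * x i : ℝ) * Complex.I) * f x with hg
  have hgi : Integrable g := by
    refine hi.bdd_mul (c := 1) ?_ (.of_forall fun x => ?_)
    · exact Continuous.aestronglyMeasurable (by fun_prop)
    · rw [← Complex.ofReal_neg, Complex.norm_exp_ofReal_mul_I]
  have hgm : ∀ x (m : Fin n → ℤ), g (x + fun i => (m i : ℝ)) =
      Complex.exp (-(2 * Real.pi * ∑ i, (q i : ℝ) * x i : ℝ) * Complex.I) *
        f (x + fun i => (m i : ℝ)) := by
    intro x m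
    simp only [hg]
    congr 1
    rw [Complex.exp_eq_exp_iff_exists_int]
    refine ⟨-∑ i, q i * m i, ?_⟩
    simp only [Pi.add_apply, mul_add, Finset.sum_add_distrib]
    push_cast
    ring
  have hcube : {x : Fin n → ℝ | ∀ i, x i ∈ Set.Ioc ((0 : Fin n → ℝ) i) ((0 : Fin n → ℝ) i + 1)} =
      unitCube 0 := by
    simp [unitCube]
  rw [UnitAddTorus.mFourierCoeff_eq_integral _ _ 0, ← (hasSum_setIntegral_unitCube hgi).tsum_eq,
    hcube, integral_tsum_of_summable_integral_norm
      (fun m => (hgi.comp_add_right _).integrableOn) (hasSum_setIntegral_unitCube hgi.norm).summable]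
  refine integral_congr_ae (.of_forall fun x => ?_)
  simp only [hgm, tsum_mul_left, mFourier_neg_coe, torusFun_coe (periodization_add_int f),
    smul_eq_mul]
  rfl

/-- **Poisson summation** for a continuous, decaying function of several variables. -/
theorem tsum_integral_exp_mul_eq {n : ℕ} {f : (Fin n → ℝ) → ℂ} (hf : Continuous f)
    (hi : Integrable f) {K : (Fin n → ℝ) → ℝ} (hK : Continuous K)
    {u : (Fin n → ℤ) → ℝ} (hu : Summable u)
    (hb : ∀ x m, ‖f (x + fun i => (m i : ℝ))‖ ≤ K x * u m)
    (hs : Summable fun q : Fin n → ℤ =>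
      ∫ x, Complex.exp (-(2 * Real.pi * ∑ i, (q i : ℝ) * x i : ℝ) * Complex.I) * f x) :
    ∑' q : Fin n → ℤ,
      ∫ x, Complex.exp (-(2 * Real.pi * ∑ i, (q i : ℝ) * x i : ℝ) * Complex.I) * f x =
      ∑' m : Fin n → ℤ, f fun i => (m i : ℝ) := by
  let F : C(UnitAddTorus (Fin n), ℂ) := ⟨torusFun (periodization f),
    continuous_torusFun (continuous_periodization hf hK hu hb) (periodization_add_int f)⟩
  have hF : UnitAddTorus.mFourierCoeff F = fun q : Fin n → ℤ =>
      ∫ x, Complex.exp (-(2 * Real.pi * ∑ i, (q i : ℝ) * x i : ℝ) * Complex.I) * f x :=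
    funext fun q => mFourierCoeff_periodization hi q
  -- At the origin every character equals 1, so the Fourier series is just the sum of the
  -- coefficients.
  have h := UnitAddTorus.hasSum_mFourier_series_apply_of_summable (f := F) (by rwa [hF])
    (fun i => ((0 : ℝ) : UnitAddCircle))
  have h0 : F (fun i => ((0 : ℝ) : UnitAddCircle)) = ∑' m : Fin n → ℤ, f fun i => (m i : ℝ) := by
    refine (torusFun_coe (periodization_add_int f) fun _ => 0).trans (tsum_congr fun m => ?_)
    congr 1
    ext i
    simp
  rw [← h0, ← h.tsum_eq, hF]
  refine tsum_congr fun q => ?_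
  have := mFourier_neg_coe (-q) fun _ => 0
  simp at this
  simp [this]

/-- **Poisson summation** for Schwartz functions of several variables. -/
theorem tsum_integral_exp_mul_schwartz_eq {n : ℕ} (Φ : 𝓢(Config n, ℂ))
    (hs : Summable fun q : Fin n → ℤ =>
      ∫ x, Complex.exp ((2 * Real.pi * inner ℝ (intVec q) x : ℝ) * Complex.I) * Φ x) :
    ∑' q : Fin n → ℤ,
      ∫ x, Complex.exp ((2 * Real.pi * inner ℝ (intVec q) x : ℝ) * Complex.I) * Φ x =
      ∑' m : Fin n → ℤ, Φ (intVec m) := by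
  obtain ⟨C, hC, hΦ⟩ := exists_norm_le_inv_one_add_norm_pow Φ (2 * n)
  have he : ∀ q : Fin n → ℤ,
      ∫ x, Complex.exp ((2 * Real.pi * inner ℝ (intVec (-q)) x : ℝ) * Complex.I) * Φ x =
      ∫ x : Fin n → ℝ, Complex.exp (-(2 * Real.pi * ∑ i, (q i : ℝ) * x i : ℝ) * Complex.I) *
        Φ (WithLp.toLp 2 x) := by
    intro q
    rw [← (PiLp.volume_preserving_toLp (Fin n)).integral_comp
      (MeasurableEquiv.toLp 2 (Fin n → ℝ)).measurableEmbedding]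
    refine integral_congr_ae (.of_forall fun x => ?_)
    simp [intVec, PiLp.inner_apply, mul_comm]
  have hb : ∀ (x : Fin n → ℝ) (m : Fin n → ℤ), ‖Φ (WithLp.toLp 2 (x + fun i => (m i : ℝ)))‖ ≤
      (1 + ‖WithLp.toLp 2 x‖) ^ (2 * n) * (C * ((1 + ‖(1 : ℝ) • intVec m‖) ^ (2 * n))⁻¹) := by
    intro x m
    refine (hΦ _).trans ?_
    -- This inequality separates growth in `x` from decay in `m`, as the domination hypothesis
    -- requires.
    have h := one_add_norm_le_mul (-WithLp.toLp 2 x) (intVec m)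
    have h1 : -WithLp.toLp 2 x - intVec m = -WithLp.toLp 2 (x + fun i => (m i : ℝ)) := by
      rw [WithLp.toLp_add, neg_add']
      rfl
    rw [h1, norm_neg, norm_neg] at h
    have h2 := pow_le_pow_left₀ (by positivity) h (2 * n)
    rw [mul_pow] at h2
    rw [one_smul, mul_left_comm]
    gcongr
    rw [← div_eq_mul_inv, le_div_iff₀ (by positivity), inv_mul_le_iff₀ (by positivity), mul_comm (_ ^ _)]
    exact h2
  have hcont : Continuous fun x : Fin n → ℝ => WithLp.toLp 2 x := PiLp.continuous_toLp 2 _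
  -- The reflection `q ↦ -q` reconciles the two sign conventions for the character.
  rw [← (Equiv.neg (Fin n → ℤ)).summable_iff] at hs
  rw [← (Equiv.neg (Fin n → ℤ)).tsum_eq]
  simp only [Equiv.neg_apply, Function.comp_def, he] at hs ⊢
  refine tsum_integral_exp_mul_eq (Φ.continuous.comp hcont) ?_
    (K := fun x => (1 + ‖WithLp.toLp 2 x‖) ^ (2 * n)) (by fun_prop)
    ((summable_inv_one_add_norm_intVec one_pos).mul_left C) hb hs
  exact ((PiLp.volume_preserving_toLp (Fin n)).integrable_comp_emb
      (MeasurableEquiv.toLp 2 (Fin n → ℝ)).measurableEmbedding).2 Φ.integrable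


/-! ### Matrix elements as Fourier integrals -/

theorem spacing_sq_mul {d : ℕ} (hd : d ≠ 0) : spacing d ^ 2 * d = 2 * Real.pi := by
  have : (d : ℝ) ≠ 0 := by positivity
  rw [spacing, Real.sq_sqrt (by positivity)]
  field_simp

theorem phasePointTerm_zero_apply {d n : ℕ} (a : (Fin n → ℤ) × (Fin n → ℤ))
    (f g : 𝓢(Config n, ℂ)) :
    phasePointTerm d (0 : PhaseSpace n) a f g =
      Complex.exp ((Real.pi * inner ℝ (intVec a.1) (intVec a.2) : ℝ) * Complex.I) *
        toGenOp (T d (intPhase a)) f g := by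
  have h : symp (intPhase a) 0 = 0 := by simp [symp]
  rw [phasePointTerm, h, mul_zero, zero_add]
  rfl

/-- The product of `g` and a translate of `f`, in rescaled coordinates. -/
def rescaledProduct {n : ℕ} (g f : 𝓢(Config n, ℂ)) (s : ℝ) (hs : s ≠ 0) (b c : Config n) :
    𝓢(Config n, ℂ) :=
  SchwartzMap.compCLMOfContinuousLinearEquiv ℂ (ContinuousLinearEquiv.smulLeft (Units.mk0 s hs))
    (SchwartzMap.compSubConstCLM ℂ b
      (SchwartzMap.smulLeftCLM ℂ g (SchwartzMap.compSubConstCLM ℂ c f)))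

theorem rescaledProduct_apply {n : ℕ} (g f : 𝓢(Config n, ℂ)) (s : ℝ) (hs : s ≠ 0)
    (b c x : Config n) :
    rescaledProduct g f s hs b c x = g (s • x - b) * f (s • x - b - c) := by
  simp only [rescaledProduct, SchwartzMap.compCLMOfContinuousLinearEquiv_apply,
    Function.comp_apply, SchwartzMap.compSubConstCLM_apply,
    SchwartzMap.smulLeftCLM_apply_apply g.hasTemperateGrowth, smul_eq_mul]
  rfl

/-- Oddness of `d` enters here: `π - ℓ²/2 = ℓ² r`, so the quadratic phase is absorbed by shifting
`x` by `ℓ r p`, an integer multiple of the spacing. Rescaling by `dℓ` then makes the character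
integral, ready for Poisson summation in `q`. -/
theorem phasePointTerm_zero_apply_eq_integral {d n r : ℕ} (hr : d = 2 * r + 1)
    (hs : (d : ℝ) * spacing d ≠ 0) (p q : Fin n → ℤ) (f g : 𝓢(Config n, ℂ)) :
    phasePointTerm d (0 : PhaseSpace n) (p, q) f g = ((d * spacing d : ℝ) : ℂ) ^ n *
      ∫ x, Complex.exp ((2 * Real.pi * inner ℝ (intVec q) x : ℝ) * Complex.I) *
        rescaledProduct g f (d * spacing d) hs ((spacing d * r) • intVec p)
          (spacing d • intVec p) x := by
  have hd : d ≠ 0 := by omega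
  have hsq := spacing_sq_mul hd
  have hpos : 0 < d * spacing d := mul_pos (by positivity) (spacing_pos hd)
  set G : Config n → ℂ := fun x =>
    Complex.exp ((spacing d * inner ℝ (intVec q) (x + (spacing d * r) • intVec p) : ℝ) * Complex.I) *
      (g x * f (x - spacing d • intVec p)) with hG
  have h1 : phasePointTerm d (0 : PhaseSpace n) (p, q) f g = ∫ x, G x := by
    rw [phasePointTerm_zero_apply, toGenOp_apply, ← integral_const_mul]
    refine integral_congr_ae (.of_forall fun x => ?_)
    simp only [T_apply, hG, intPhase]
    rw [mul_left_comm (g x), ← mul_assoc, ← Complex.exp_add, ← add_mul, ← Complex.ofReal_add]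
    congr 4
    rw [inner_add_right, real_inner_smul_right, real_inner_comm (intVec q) (intVec p)]
    have hd' : (d : ℝ) = 2 * r + 1 := by rw [hr]; push_cast; ring
    rw [hd'] at hsq
    linear_combination (-(1 / 2 : ℝ)) * inner ℝ (intVec q) (intVec p) * hsq
  have h2 : ∀ x : Config n, Complex.exp ((2 * Real.pi * inner ℝ (intVec q) x : ℝ) * Complex.I) *
      rescaledProduct g f (d * spacing d) hs ((spacing d * r) • intVec p)
          (spacing d • intVec p) x = G ((d * spacing d) • x - (spacing d * r) • intVec p) := by
    intro x
    simp only [hG, rescaledProduct_apply, sub_add_cancel, real_inner_smul_right]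
    congr 4
    linear_combination (-inner ℝ (intVec q) x) * hsq
  rw [h1]
  simp_rw [h2]
  -- The Jacobian `(dℓ)⁻ⁿ` of the rescaling cancels the prefactor; the shift leaves the integral
  -- unchanged.
  rw [Measure.integral_comp_smul volume (fun x => G (x - (spacing d * r) • intVec p)),
    integral_sub_right_eq_self, finrank_euclideanSpace_fin, abs_of_pos (by positivity),
    Complex.real_smul]
  push_cast
  rw [mul_inv_cancel_left₀]
  exact_mod_cast (pow_pos hpos n).ne'

theorem summable_phasePointTerm_zero_apply {d : ℕ} (hd : d ≠ 0) {n : ℕ} (f g : 𝓢(Config n, ℂ)) :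
    Summable fun a : (Fin n → ℤ) × (Fin n → ℤ) =>
      phasePointTerm d (0 : PhaseSpace n) a f g := by
  refine .of_norm_bounded (summable_norm_toGenOp_T hd f g) fun a => le_of_eq ?_
  rw [phasePointTerm_zero_apply, norm_mul, Complex.norm_exp_ofReal_mul_I, one_mul]

/-! ### Reindexing the lattice -/

/-- Pairs `(u, v) = (d m - j, d m' + j)` of integers with sum divisible by `d = 2 r + 1`, in the
coordinates `(p, k)` with `p = u - v` and `u = d k - r p`. -/
def latticeEquiv (r : ℕ) : (Fin (2 * r + 1) × (ℤ × ℤ)) ≃ ℤ × ℤ :=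
  Equiv.ofBijective (fun t => ((2 * r + 1) * (t.2.2 - t.2.1) - 2 * (t.1 : ℤ),
    t.2.2 + r * (t.2.2 - t.2.1) - (t.1 : ℤ))) (by
  constructor
  · rintro ⟨j, m', m⟩ ⟨i, l', l⟩ h
    simp only [Prod.mk.injEq] at h
    obtain ⟨h1, h2⟩ := h
    -- `v = dk - (r + 1)p` is determined by `(p, k)`, and Euclidean division of `v` by `d` recovers
    -- `m'` and `j`.
    have hv : (2 * r + 1 : ℤ) * m' + j = (2 * r + 1) * l' + i := by
      linear_combination (2 * r + 1 : ℤ) * h2 - (r + 1 : ℤ) * h1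
    have hj : (j : ℤ) < 2 * r + 1 := by exact_mod_cast j.2
    have hi : (i : ℤ) < 2 * r + 1 := by exact_mod_cast i.2
    have hm : m' = l' := by
      have e1 : ((2 * r + 1 : ℤ) * m' + j) / (2 * r + 1) = m' := by
        rw [Int.mul_add_ediv_left _ _ (by positivity), Int.ediv_eq_zero_of_lt (by positivity) hj,
          add_zero]
      have e2 : ((2 * r + 1 : ℤ) * l' + i) / (2 * r + 1) = l' := by
        rw [Int.mul_add_ediv_left _ _ (by positivity), Int.ediv_eq_zero_of_lt (by positivity) hi,
          add_zero]
      rw [← e1, ← e2, hv]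
    subst hm
    have hji : j = i := by
      ext
      have : (j : ℤ) = i := by linarith
      exact_mod_cast this
    subst hji
    have h3 : (2 * r + 1 : ℤ) * m = (2 * r + 1) * l := by linear_combination h1
    have h4 : m = l := mul_left_cancel₀ (by positivity) h3
    rw [h4]
  · rintro ⟨p, k⟩
    set v : ℤ := (2 * r + 1) * k - (r + 1) * p with hv
    have hpos : (0 : ℤ) < 2 * r + 1 := by positivity
    have h0 := Int.emod_nonneg v hpos.ne'
    have h1 := Int.emod_lt_of_pos v hpos
    have h2 := Int.emod_add_mul_ediv v (2 * r + 1)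
    set j := v % (2 * r + 1)
    set m' := v / (2 * r + 1)
    -- The last coordinate is forced by `u + v = d(2k - p) = d(m + m')`.
    refine ⟨(⟨j.toNat, by omega⟩, m', 2 * k - p - m'), ?_⟩
    simp only [Int.toNat_of_nonneg h0, Prod.mk.injEq]
    constructor
    · linear_combination (-2 : ℤ) * h2 + (-2 : ℤ) * hv
    · linear_combination (-1 : ℤ) * h2 + (-1 : ℤ) * hv)

theorem latticeEquiv_fst (r : ℕ) (j : Fin (2 * r + 1)) (m' m : ℤ) :
    (latticeEquiv r (j, m', m)).1 = (2 * r + 1) * (m - m') - 2 * (j : ℤ) := rfl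

theorem latticeEquiv_snd (r : ℕ) (j : Fin (2 * r + 1)) (m' m : ℤ) :
    (latticeEquiv r (j, m', m)).2 = m + r * (m - m') - (j : ℤ) := rfl

/-- `latticeEquiv` applied in each mode. -/
def latticeEquivPi (r n : ℕ) :
    ((Fin n → Fin (2 * r + 1)) × ((Fin n → ℤ) × (Fin n → ℤ))) ≃ (Fin n → ℤ) × (Fin n → ℤ) :=
  (((Equiv.refl _).prodCongr (Equiv.arrowProdEquivProdArrow _ _ _).symm).trans
    (Equiv.arrowProdEquivProdArrow _ _ _).symm).trans
    ((Equiv.piCongrRight fun _ => latticeEquiv r).trans (Equiv.arrowProdEquivProdArrow _ _ _))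

theorem latticeEquivPi_apply (r n : ℕ) (j : Fin n → Fin (2 * r + 1)) (m' m : Fin n → ℤ) :
    latticeEquivPi r n (j, m', m) = (fun i => (latticeEquiv r (j i, m' i, m i)).1,
      fun i => (latticeEquiv r (j i, m' i, m i)).2) := rfl

/-! ### Comparison with the logical parity -/

/-- A GKP state is a real combination of point evaluations, so the two conjugations in the bra
cancel. -/
theorem bra_gkpKetMulti {d n : ℕ} (hd : d ≠ 0) (j : Fin n → ℤ) (f : 𝓢(Config n, ℂ)) :
    bra (gkpKetMulti d j) f = gkpKetMulti d j f := by
  change (starRingEnd ℂ) (gkpKetMulti d j (conjS f)) = _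
  rw [gkpKetMulti_apply hd, gkpKetMulti_apply hd, map_mul, Complex.conj_tsum]
  simp [conjS_apply]

theorem logicalParity_apply {d n : ℕ} (hd : d ≠ 0) (f g : 𝓢(Config n, ℂ)) :
    logicalParity d n f g = (1 / (spacing d : ℂ)) ^ n * ∑ j : Fin n → Fin d,
      (∑' m : Fin n → ℤ, f (spacing d • intVec fun k => d * m k + (j k : ℤ))) *
        ∑' m : Fin n → ℤ, g (spacing d • intVec fun k => d * m k + -(j k : ℤ)) := by
  have h : logicalParity d n f g = ∑ j : Fin n → Fin d,
      bra (gkpKetMulti d fun k => (j k : ℤ)) f * gkpKetMulti d (fun k => -(j k : ℤ)) g := by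
    simp [logicalParity, ketBra_apply, bra]
  have hl : (1 / Real.sqrt (spacing d) : ℂ) * (1 / Real.sqrt (spacing d) : ℂ) =
      1 / (spacing d : ℂ) := by
    rw [div_mul_div_comm, one_mul, ← Complex.ofReal_mul, Real.mul_self_sqrt (spacing_pos hd).le]
  rw [h, Finset.mul_sum]
  refine Finset.sum_congr rfl fun j _ => ?_
  rw [bra_gkpKetMulti hd, gkpKetMulti_apply hd, gkpKetMulti_apply hd, ← hl, mul_pow]
  ring

theorem tsum_phasePointTerm_zero_apply {d n : ℕ} (hd : Odd d) (f g : 𝓢(Config n, ℂ)) :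
    ∑' a : (Fin n → ℤ) × (Fin n → ℤ), phasePointTerm d (0 : PhaseSpace n) a f g =
      (2 * Real.pi : ℂ) ^ n * logicalParity d n f g := by
  obtain ⟨r, rfl⟩ := hd
  set d := 2 * r + 1 with hr
  have hd0 : d ≠ 0 := by omega
  have hl := spacing_pos hd0
  have hpos : 0 < d * spacing d := mul_pos (by positivity) hl
  have hs := summable_phasePointTerm_zero_apply hd0 f g
  set h : (Fin n → ℤ) × (Fin n → ℤ) → ℂ := fun t =>
    rescaledProduct g f (d * spacing d) hpos.ne' ((spacing d * r) • intVec t.1)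
      (spacing d • intVec t.1) (intVec t.2) with hh
  -- The Poisson sample points in the coordinates `(j, m', m)`: `f` is evaluated at `ℓv` and `g` at
  -- `ℓu`.
  have h1 : ∀ (j : Fin n → Fin d) (m' m : Fin n → ℤ), h (latticeEquivPi r n (j, m', m)) =
      f (spacing d • intVec fun k => d * m' k + (j k : ℤ)) *
        g (spacing d • intVec fun k => d * m k + -(j k : ℤ)) := by
    intro j m' m
    simp only [hh, rescaledProduct_apply, latticeEquivPi_apply]
    rw [mul_comm]
    have hdr : (d : ℝ) = 2 * r + 1 := by rw [hr]; push_cast; ring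
    congr 2
    · ext i
      simp [intVec, latticeEquiv_fst, latticeEquiv_snd, hdr]
      ring
    · ext i
      simp [intVec, latticeEquiv_fst, latticeEquiv_snd, hdr]
      ring
  have hf : ∀ j : Fin n → Fin d, Summable fun m : Fin n → ℤ =>
      ‖f (spacing d • intVec fun k => d * m k + (j k : ℤ))‖ := fun j =>
    (hasSum_positionKet _ _ (summable_combMulti hd0 fun k => (j k : ℤ)) f).2.1
  have hg : ∀ j : Fin n → Fin d, Summable fun m : Fin n → ℤ =>
      ‖g (spacing d • intVec fun k => d * m k + -(j k : ℤ))‖ := fun j =>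
    (hasSum_positionKet _ _ (summable_combMulti hd0 fun k => -(j k : ℤ)) g).2.1
  -- Summability after Poisson summation is obtained on the comb side: for each of the finitely many
  -- `j`, the terms are products of two absolutely summable families.
  have hsum : Summable fun t => h (latticeEquivPi r n t) := by
    refine .of_norm ((summable_prod_of_nonneg fun t => norm_nonneg _).2
      ⟨fun j => ?_, .of_finite⟩)
    exact ((hf j).mul_norm (hg j)).congr fun t => by rw [h1]
  have hh' : Summable h := (latticeEquivPi r n).summable_iff.1 hsum
  have h2 : ∀ p : Fin n → ℤ, ∑' q, phasePointTerm d (0 : PhaseSpace n) (p, q) f g =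
      ((d * spacing d : ℝ) : ℂ) ^ n * ∑' k, h (p, k) := by
    intro p
    have h3 := hs.prod_factor p
    have h4 : (((d * spacing d : ℝ) : ℂ) ^ n) ≠ 0 := by exact_mod_cast (pow_pos hpos n).ne'
    simp only [phasePointTerm_zero_apply_eq_integral hr hpos.ne'] at h3 ⊢
    rw [tsum_mul_left, tsum_integral_exp_mul_schwartz_eq _ ((summable_mul_left_iff h4).1 h3)]
  rw [hs.tsum_prod]
  simp_rw [h2]
  rw [tsum_mul_left, ← hh'.tsum_prod, ← (latticeEquivPi r n).tsum_eq, hsum.tsum_prod, tsum_fintype,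
    logicalParity_apply hd0, ← mul_assoc, ← mul_pow]
  congr 1
  -- The constants agree because `dℓ = 2π/ℓ`.
  · congr 1
    have h5 : (spacing d : ℂ) ≠ 0 := by exact_mod_cast hl.ne'
    have h6 : (spacing d : ℂ) ^ 2 * d = 2 * Real.pi := by exact_mod_cast spacing_sq_mul hd0
    rw [← h6]
    push_cast
    field_simp
  · refine Finset.sum_congr rfl fun j _ => ?_
    rw [tsum_mul_tsum_of_summable_norm (hf j) (hg j)]
    exact tsum_congr fun t => h1 j t.1 t.2

/-- Operators and distributions both carry topologies of pointwise convergence, so unconditional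
convergence is tested on scalar matrix elements. -/
theorem hasSum_phasePointTerm_zero {d n : ℕ} (hd : Odd d) :
    HasSum (fun a : (Fin n → ℤ) × (Fin n → ℤ) => phasePointTerm d (0 : PhaseSpace n) a)
      ((2 * Real.pi : ℂ) ^ n • logicalParity d n) := by
  unfold HasSum
  rw [PointwiseConvergenceCLM.tendsto_iff_forall_tendsto]
  intro f
  rw [PointwiseConvergenceCLM.tendsto_iff_forall_tendsto]
  intro g
  have h := (summable_phasePointTerm_zero_apply hd.pos.ne' f g).hasSum
  rw [tsum_phasePointTerm_zero_apply hd] at h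
  unfold HasSum at h
  refine h.congr fun s => ?_
  simp

end GKP

end

theorem lemma3 (d n : ℕ) (hd : Odd d) :
    Summable (fun a : (Fin n → ℤ) × (Fin n → ℤ) => GKP.phasePointTerm d (0 : GKP.PhaseSpace n) a) ∧
      GKP.phasePoint d (0 : GKP.PhaseSpace n) = GKP.logicalParity d n := by
  have h := GKP.hasSum_phasePointTerm_zero (n := n) hd
  refine ⟨h.summable, ?_⟩
  have h0 : (2 * Real.pi : ℂ) ^ n ≠ 0 := pow_ne_zero _ (by simp [Real.pi_ne_zero])
  rw [GKP.phasePoint, h.tsum_eq, smul_smul, one_div_mul_cancel h0, one_smul]
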